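/- Let $h:\mathbb{R}^m\to[-\infty,+\infty]$ be lower semicontinuous, let $\bar z\in\mathbb{R}^m$ be a point where $h(\bar z)$ is finite, and let $\bar G:\mathbb{R}^n\to\mathbb{R}^m$ be a linear map satisfying \[ \partial^\infty h(\bar z)\cap \mathrm{Null}(\bar G^*)=\{0\}. \] Here $\bar G^*$ is the adjoint of $\bar G$ for the Euclidean inner products, and the horizon subdifferential $\partial^\infty h(\bar z)$ is the set of all limits $v=\lim_k t_k u_k$, where $t_k>0$, $t_k\to 0$, and $u_k\in\hat\partial h(x_k)$ for some points $x_k\to\bar z$ with $h(x_k)\to h(\bar z)$; the regular subdifferential $\hat\partial h(x)$ at a point $x$ where $h$ is finite is the set of all $u$ such that $h(y)\ge h(x)+\langle u,y-x\rangle+o(|y-x|)$ as $y\to x$ (and it is empty where $h$ is not finite). Then there exists a constant $\gamma>0$ such that, for all vectors $z\in\mathbb{R}^m$ and linear maps $G:\mathbb{R}^n\to\mathbb{R}^m$ with $(z,G)$ sufficiently near $(\bar z,\bar G)$, there exists a vector $w\in\mathbb{R}^n$ satisfying \[ |w|\le\gamma|z-\bar z|\quad\text{and}\quad h(z+Gw)\le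 h(\bar z)+\gamma|z-\bar z|. \] -/

import Mathlib

open Filter Topology

/-- The regular (Fréchet) subdifferential of an extended-real-valued function `h` at `x`:
the vectors `v` such that `h x` is finite and
`h y ≥ h x + ⟪v, y - x⟫ + o(‖y - x‖)` as `y → x`. -/
def regularSubdifferential {E : Type*} [NormedAddCommGroup E] [InnerProductSpace ℝ E]
    (h : E → EReal) (x : E) : Set E :=
  {v | h x ≠ ⊥ ∧ h x ≠ ⊤ ∧
    ∀ ε : ℝ, 0 < ε → ∀ᶠ y in 𝓝 x,
      h x + ((inner ℝ v (y - x) - ε * ‖y - x‖ : ℝ) : EReal) ≤ h y}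

/-- The horizon subdifferential of `h` at `z`: the limits of sequences `t k • u k`, where
`t k > 0` tends to zero and `u k` is a regular subgradient of `h` at `x k`, for some sequence
`x k → z` with `h (x k) → h z`. -/
def horizonSubdifferential {E : Type*} [NormedAddCommGroup E] [InnerProductSpace ℝ E]
    (h : E → EReal) (z : E) : Set E :=
  {v | ∃ (x : ℕ → E) (u : ℕ → E) (t : ℕ → ℝ),
    Tendsto x atTop (𝓝 z) ∧
    Tendsto (fun k => h (x k)) atTop (𝓝 (h z)) ∧
    (∀ k, u k ∈ regularSubdifferential h (x k)) ∧
    (∀ k, 0 < t k) ∧ Tendsto t atTop (𝓝 0) ∧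
    Tendsto (fun k => t k • u k) atTop (𝓝 v)}

/-! ### Quadratic upper bounds and a smooth penalty for increase of `h`. -/

section Smoothing

/-! Suppose the claim fails for γ = 2/ε at some (z, G) near (z̄, Ḡ), and put δ = |z - z̄|. On a
compact piece of the epigraph of h times a ball, minimize |x - z - Gw| + ε ψ(s - h(z̄)) + ε|w|,
where ψ is `smoothPosPart δ`. Comparison with (z̄, h(z̄), 0) bounds the minimum by 2δ, so |w| and s
- h(z̄) are at most γδ, and the residual x - z - Gw cannot vanish, as w would then be a solution.
The norm is therefore smooth at the residual. Optimality in (x, s) gives a unit vector u and 0 < a ≤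
2ε with u/a a regular subgradient at x; optimality in w gives |G*u| ≤ ε
(`exists_regularSubgradient_of_no_solution`). As ε → 0, a limit of the u's is a unit horizon
subgradient in the null space of Ḡ* (`exists_unit_mem_horizonSubdifferential`), a contradiction. -/

lemma le_add_sq_sub_sq_div {a c : ℝ} (ha : 0 < a) : c ≤ a + (c ^ 2 - a ^ 2) / (2 * a) := by
  have e : a + (c ^ 2 - a ^ 2) / (2 * a) = (a ^ 2 + c ^ 2) / (2 * a) := by field_simp; ring
  rw [e, le_div_iff₀ (by positivity)]
  nlinarith [sq_nonneg (a - c)]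

/-- A smooth strictly increasing positive function, close to `2 * max t 0` for small `δ`. -/
noncomputable def smoothPosPart (δ t : ℝ) : ℝ := t + √(t ^ 2 + δ ^ 2)

lemma smoothPosPart_pos {δ : ℝ} (hδ : 0 < δ) (t : ℝ) : 0 < smoothPosPart δ t := by
  have : |t| < √(t ^ 2 + δ ^ 2) := by
    rw [← Real.sqrt_sq_eq_abs]
    exact Real.sqrt_lt_sqrt (sq_nonneg t) (by nlinarith)
  unfold smoothPosPart
  linarith [neg_abs_le t]

lemma le_smoothPosPart (δ t : ℝ) : t ≤ smoothPosPart δ t :=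
  le_add_of_nonneg_right (Real.sqrt_nonneg _)

lemma smoothPosPart_zero {δ : ℝ} (hδ : 0 < δ) : smoothPosPart δ 0 = δ := by
  simp [smoothPosPart, Real.sqrt_sq hδ.le]

lemma continuous_smoothPosPart (δ : ℝ) : Continuous (smoothPosPart δ) := by
  unfold smoothPosPart
  fun_prop

lemma smoothPosPart_strictMono {δ : ℝ} (hδ : 0 < δ) : StrictMono (smoothPosPart δ) := by
  intro s t hst
  by_contra! hle
  -- With ψ the value at r, r = (ψ - δ²/ψ)/2 increases with ψ > 0.
  have key : ∀ r, smoothPosPart δ r * (smoothPosPart δ r - 2 * r) = δ ^ 2 := fun r => by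
    have := Real.sq_sqrt (show 0 ≤ r ^ 2 + δ ^ 2 by positivity)
    unfold smoothPosPart
    linear_combination this
  have hs := key s
  have ht := key t
  have ps := smoothPosPart_pos hδ s
  have pt := smoothPosPart_pos hδ t
  nlinarith [mul_pos pt (sub_pos.2 hst), sq_nonneg δ, pow_pos hδ 2,
    pos_of_mul_pos_right (hs.symm ▸ pow_pos hδ 2) ps.le]

lemma smoothPosPart_add_le {δ : ℝ} (hδ : 0 < δ) (t τ : ℝ) :
    smoothPosPart δ (t + τ) ≤ smoothPosPart δ t + τ * (1 + t / √(t ^ 2 + δ ^ 2)) +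
      τ ^ 2 / (2 * √(t ^ 2 + δ ^ 2)) := by
  have hS : 0 < √(t ^ 2 + δ ^ 2) := Real.sqrt_pos.2 (by positivity)
  have h1 := le_add_sq_sub_sq_div (c := √((t + τ) ^ 2 + δ ^ 2)) hS
  rw [Real.sq_sqrt (by positivity), Real.sq_sqrt (by positivity)] at h1
  have e : ((t + τ) ^ 2 + δ ^ 2 - (t ^ 2 + δ ^ 2)) / (2 * √(t ^ 2 + δ ^ 2)) =
      τ * (t / √(t ^ 2 + δ ^ 2)) + τ ^ 2 / (2 * √(t ^ 2 + δ ^ 2)) := by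
    field_simp; ring
  unfold smoothPosPart
  linarith

/-- Positivity of the slope lets the optimality condition be divided by it; the bound 2 keeps the
multiplier `a` of order ε. -/
lemma smoothPosPart_slope_mem {δ : ℝ} (hδ : 0 < δ) (t : ℝ) :
    0 < 1 + t / √(t ^ 2 + δ ^ 2) ∧ 1 + t / √(t ^ 2 + δ ^ 2) ≤ 2 := by
  have hS : 0 < √(t ^ 2 + δ ^ 2) := Real.sqrt_pos.2 (by positivity)
  have hp := smoothPosPart_pos hδ t
  unfold smoothPosPart at hp
  have e : 1 + t / √(t ^ 2 + δ ^ 2) = (t + √(t ^ 2 + δ ^ 2)) / √(t ^ 2 + δ ^ 2) := by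
    field_simp; ring
  rw [e]
  refine ⟨div_pos hp hS, (div_le_iff₀ hS).2 ?_⟩
  have : t ≤ √(t ^ 2 + δ ^ 2) := Real.le_sqrt_of_sq_le (by nlinarith)
  linarith

end Smoothing

/-! ### First-order conditions at a minimizer. -/

section Optimality

variable {E F : Type*} [NormedAddCommGroup E] [InnerProductSpace ℝ E]
  [NormedAddCommGroup F] [InnerProductSpace ℝ F]

lemma norm_add_le_add_inner {p : E} (hp : p ≠ 0) (q : E) :
    ‖p + q‖ ≤ ‖p‖ + inner ℝ (‖p‖⁻¹ • p) q + ‖q‖ ^ 2 / (2 * ‖p‖) := by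
  have hp' : 0 < ‖p‖ := norm_pos_iff.2 hp
  have h1 := le_add_sq_sub_sq_div (c := ‖p + q‖) hp'
  have e : (‖p + q‖ ^ 2 - ‖p‖ ^ 2) / (2 * ‖p‖) =
      inner ℝ (‖p‖⁻¹ • p) q + ‖q‖ ^ 2 / (2 * ‖p‖) := by
    rw [norm_add_sq_real, real_inner_smul_left]
    field_simp
    ring
  linarith

/-- First-order optimality in the function variable: a local minimizer of the distance to `c` plus
a smooth increasing function of `h` yields a regular subgradient of `h`. -/
lemma mem_regularSubdifferential_of_isMin {h : E → EReal} {x c : E} {s h₀ b ε δ : ℝ}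
    (hx : h x = s) (hxc : x - c ≠ 0) (hε : 0 < ε) (hδ : 0 < δ) (hsb : s < b)
    (hmin : ∀ᶠ y in 𝓝 x, ∀ r : ℝ, h y ≤ r → r ≤ b →
      ‖x - c‖ + ε * smoothPosPart δ (s - h₀) ≤ ‖y - c‖ + ε * smoothPosPart δ (r - h₀)) :
    (ε * (1 + (s - h₀) / √((s - h₀) ^ 2 + δ ^ 2)))⁻¹ • -(‖x - c‖⁻¹ • (x - c)) ∈
      regularSubdifferential h x := by
  set S := √((s - h₀) ^ 2 + δ ^ 2) with hS_def
  have hS : 0 < S := Real.sqrt_pos.2 (by positivity)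
  have hslope := (smoothPosPart_slope_mem hδ (s - h₀)).1
  set a := ε * (1 + (s - h₀) / S) with ha_def
  have ha : 0 < a := mul_pos hε hslope
  set p := x - c with hp_def
  have hp : 0 < ‖p‖ := norm_pos_iff.2 hxc
  set u := ‖p‖⁻¹ • p with hu_def
  set v := a⁻¹ • -u with hv_def
  refine ⟨by simp [hx], by simp [hx], fun η hη => ?_⟩
  -- `C` collects the quadratic remainders of the norm and of the penalty, using |τ| ≤ (‖v‖ + η)‖q‖
  -- for the `τ` below.
  set C := 1 / (2 * ‖p‖) + ε / (2 * S) * (‖v‖ + η) ^ 2 with hC_def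
  have hcont1 : ∀ᶠ y in 𝓝 x, s + (inner ℝ v (y - x) - η * ‖y - x‖) < b := by
    have : Continuous fun y : E => s + (inner ℝ v (y - x) - η * ‖y - x‖) := by fun_prop
    exact this.continuousAt.eventually_lt continuousAt_const (by simpa using hsb)
  have hcont2 : ∀ᶠ y in 𝓝 x, C * ‖y - x‖ < a * η := by
    have : Continuous fun y : E => C * ‖y - x‖ := by fun_prop
    exact this.continuousAt.eventually_lt continuousAt_const (by simpa using mul_pos ha hη)
  filter_upwards [hmin, hcont1, hcont2] with y hy h1 h2
  by_contra! hlt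
  set q := y - x with hq_def
  set τ := inner ℝ v q - η * ‖q‖ with hτ_def
  rw [hx, ← EReal.coe_add] at hlt
  -- If the subgradient inequality fails, (y, s + τ) lies in the epigraph. The first-order change
  -- there is -aη‖q‖, which beats the remainder C‖q‖².
  have hopt := hy (s + τ) hlt.le h1.le
  have hq : 0 < ‖q‖ := by
    rw [norm_pos_iff]
    intro hq0
    have hyx : y = x := sub_eq_zero.1 hq0
    simp [hτ_def, hq0, hyx, hx] at hlt
  have e1 : y - c = p + q := by rw [hp_def, hq_def]; abel
  have e2 : s + τ - h₀ = (s - h₀) + τ := by ring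
  rw [e1, e2] at hopt
  have b1 := norm_add_le_add_inner hxc q
  have b2 := mul_le_mul_of_nonneg_left (smoothPosPart_add_le hδ (s - h₀) τ) hε.le
  rw [← hS_def] at b2
  have haτ : a * τ = -inner ℝ u q - a * η * ‖q‖ := by
    rw [hτ_def, hv_def, real_inner_smul_left, inner_neg_left]
    field_simp
  have hτ : τ ^ 2 ≤ ((‖v‖ + η) * ‖q‖) ^ 2 := by
    refine sq_le_sq' ?_ ?_
    · have := neg_le_of_abs_le (abs_real_inner_le_norm v q)
      rw [hτ_def]; linarith
    · have := real_inner_le_norm v q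
      have := mul_pos hη hq
      rw [hτ_def]; linarith
  have hτ' : ε * (τ ^ 2 / (2 * S)) ≤ ε / (2 * S) * (‖v‖ + η) ^ 2 * ‖q‖ ^ 2 := by
    calc ε * (τ ^ 2 / (2 * S)) = ε / (2 * S) * τ ^ 2 := by ring
      _ ≤ ε / (2 * S) * ((‖v‖ + η) * ‖q‖) ^ 2 := by gcongr
      _ = _ := by ring
  have hfin : a * η * ‖q‖ ≤ C * ‖q‖ * ‖q‖ := by
    have : C * ‖q‖ * ‖q‖ =
        ‖q‖ ^ 2 / (2 * ‖p‖) + ε / (2 * S) * (‖v‖ + η) ^ 2 * ‖q‖ ^ 2 := by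
      rw [hC_def]; ring
    have : ε * (τ * (1 + (s - h₀) / S)) = a * τ := by rw [ha_def]; ring
    linarith
  exact absurd (le_of_mul_le_mul_right hfin hq) (not_le.2 h2)

/-- First-order optimality in the linear variable. -/
lemma norm_adjoint_le_of_isMin [CompleteSpace E] [CompleteSpace F] {G : F →L[ℝ] E} {c : E} {w : F}
    {ε : ℝ} (hne : c - G w ≠ 0)
    (hmin : ∀ᶠ w' in 𝓝 w, ‖c - G w‖ + ε * ‖w‖ ≤ ‖c - G w'‖ + ε * ‖w'‖) (hε : 0 ≤ ε) :
    ‖ContinuousLinearMap.adjoint G (‖c - G w‖⁻¹ • (c - G w))‖ ≤ ε := by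
  set p := c - G w with hp_def
  set u := ‖p‖⁻¹ • p with hu_def
  set d := ContinuousLinearMap.adjoint G u with hd_def
  set K := ‖G d‖ ^ 2 / (2 * ‖p‖) with hK_def
  -- Moving `w` along `d` lowers the residual at rate ‖d‖² and costs at most ε‖d‖, so ‖d‖² ≤ ε‖d‖.
  have hlim : Tendsto (fun τ : ℝ => w + τ • d) (𝓝[>] 0) (𝓝 w) := by
    have : Continuous fun τ : ℝ => w + τ • d := by fun_prop
    simpa using (this.tendsto 0).mono_left nhdsWithin_le_nhds
  have hev : ∀ᶠ τ : ℝ in 𝓝[>] 0, ‖d‖ ^ 2 - ε * ‖d‖ ≤ τ * K := by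
    filter_upwards [hlim.eventually hmin, self_mem_nhdsWithin] with τ hτ hpos
    have hpos : 0 < τ := hpos
    have e : c - G (w + τ • d) = p + (-τ) • G d := by
      rw [hp_def, map_add, map_smul, neg_smul]; abel
    have b1 := norm_add_le_add_inner hne ((-τ) • G d)
    have b2 : inner ℝ u ((-τ) • G d) = -τ * ‖d‖ ^ 2 := by
      rw [real_inner_smul_right, ← ContinuousLinearMap.adjoint_inner_left, ← hd_def,
        real_inner_self_eq_norm_sq]
    have b3 : ‖w + τ • d‖ ≤ ‖w‖ + τ * ‖d‖ := by
      refine (norm_add_le _ _).trans ?_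
      rw [norm_smul, Real.norm_of_nonneg hpos.le]
    have b4 : ‖(-τ) • G d‖ ^ 2 / (2 * ‖p‖) = τ * (τ * K) := by
      rw [norm_smul, norm_neg, Real.norm_of_nonneg hpos.le, hK_def]; ring
    rw [e] at hτ
    rw [b2, b4] at b1
    have b5 := mul_le_mul_of_nonneg_left b3 hε
    refine le_of_mul_le_mul_left ?_ hpos
    linarith
  have hK : Tendsto (fun τ : ℝ => τ * K) (𝓝[>] 0) (𝓝 0) := by
    have : Continuous fun τ : ℝ => τ * K := by fun_prop
    simpa using (this.tendsto 0).mono_left nhdsWithin_le_nhds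
  have := ge_of_tendsto hK hev
  by_contra! hlt
  nlinarith

/-! ### The penalized minimization and the limit ε → 0. -/

/-- If the perturbed inequality has no solution of size proportional to the perturbation, then
there is an almost-horizontal regular subgradient almost annihilated by the adjoint of `G`. -/
lemma exists_regularSubgradient_of_no_solution [ProperSpace E] [ProperSpace F] {h : E → EReal}
    (hlsc : LowerSemicontinuous h) {zbar z : E} {h₀ ρ η ε : ℝ} (h0 : h zbar = h₀)
    (hlow : ∀ x, ‖x - zbar‖ ≤ ρ → ((h₀ - η : ℝ) : EReal) < h x)
    (G : F →L[ℝ] E) (hε : 0 < ε) (hε1 : ε ≤ 1) (hz : z ≠ zbar)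
    (hsmall : 3 * ‖z - zbar‖ + ‖G‖ * (2 / ε * ‖z - zbar‖) < ρ) (hη : 2 / ε * ‖z - zbar‖ < η)
    (hno : ∀ w : F, ‖w‖ ≤ 2 / ε * ‖z - zbar‖ →
      ¬ h (z + G w) ≤ h₀ + ((2 / ε * ‖z - zbar‖ : ℝ) : EReal)) :
    ∃ (x u : E) (s a : ℝ), h x = s ∧ ‖x - zbar‖ ≤ ρ ∧ |s - h₀| ≤ η ∧ ‖u‖ = 1 ∧
      ‖ContinuousLinearMap.adjoint G u‖ ≤ ε ∧ 0 < a ∧ a ≤ 2 * ε ∧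
      a⁻¹ • u ∈ regularSubdifferential h x := by
  set δ := ‖z - zbar‖ with hδ_def
  have hδ : 0 < δ := norm_pos_iff.2 (sub_ne_zero.2 hz)
  have hR : 0 < 2 / ε * δ := by positivity
  set R := 2 / ε * δ with hR_def
  have hεR : ε * R = 2 * δ := by rw [hR_def]; field_simp
  have hρ : 0 < ρ := by have := norm_nonneg G; nlinarith [mul_nonneg this hR.le]
  let Φ : E × ℝ × F → ℝ := fun P =>
    ‖P.1 - z - G P.2.2‖ + ε * smoothPosPart δ (P.2.1 - h₀) + ε * ‖P.2.2‖
  let K : Set (E × ℝ × F) :=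
    (Metric.closedBall zbar ρ ×ˢ Set.Icc (h₀ - η) (h₀ + η) ×ˢ Metric.closedBall 0 (R + 1)) ∩
      {P | h P.1 ≤ P.2.1}
  have hclosed : IsClosed {P : E × ℝ × F | h P.1 ≤ P.2.1} := by
    have hc : Continuous fun P : E × ℝ × F => (P.1, (P.2.1 : EReal)) :=
      continuous_fst.prodMk (continuous_coe_real_ereal.comp (continuous_fst.comp continuous_snd))
    exact hlsc.isClosed_epigraph.preimage hc
  have hK : IsCompact K := by
    refine IsCompact.inter_right ?_ hclosed
    exact (isCompact_closedBall _ _).prod (isCompact_Icc.prod (isCompact_closedBall _ _))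
  have hΦ : Continuous Φ := by
    have := continuous_smoothPosPart δ
    fun_prop
  have hmem0 : (zbar, h₀, (0 : F)) ∈ K := by
    refine ⟨⟨by simp [hρ.le], ⟨⟨by linarith, by linarith⟩, by simp; linarith⟩⟩, by simp [h0]⟩
  obtain ⟨⟨x, s, w⟩, ⟨⟨hxρ, ⟨hs1, hs2⟩, hwR⟩, hxs⟩, hmin⟩ :=
    hK.exists_isMinOn ⟨_, hmem0⟩ hΦ.continuousOn
  have hmin' : ∀ (y : E) (r : ℝ) (w' : F), ‖y - zbar‖ ≤ ρ → r ≤ h₀ + η → ‖w'‖ ≤ R + 1 →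
      h y ≤ r → ‖x - z - G w‖ + ε * smoothPosPart δ (s - h₀) + ε * ‖w‖ ≤
        ‖y - z - G w'‖ + ε * smoothPosPart δ (r - h₀) + ε * ‖w'‖ := by
    intro y r w' h1 h2 h3 h4
    have h5 : h₀ - η < r := EReal.coe_lt_coe_iff.1 ((hlow y h1).trans_le h4)
    exact hmin (a := (y, r, w'))
      ⟨⟨by simpa [dist_eq_norm] using h1, ⟨h5.le, h2⟩, by simpa using h3⟩, h4⟩
  have hxρ' : ‖x - zbar‖ ≤ ρ := by simpa [dist_eq_norm] using hxρ
  have hxs : h x ≤ s := hxs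
  have hval := hmin' zbar h₀ 0 (by simp [hρ.le]) (by linarith) (by simp; linarith) h0.le
  rw [sub_self, smoothPosPart_zero hδ, map_zero, sub_zero, norm_zero, mul_zero, add_zero,
    norm_sub_rev zbar z, ← hδ_def] at hval
  have hψ := smoothPosPart_pos hδ (s - h₀)
  have hεδ : ε * δ ≤ δ := by nlinarith
  have hεw : 0 ≤ ε * ‖w‖ := by positivity
  have hεψ : 0 < ε * smoothPosPart δ (s - h₀) := by positivity
  have hn0 := norm_nonneg (x - z - G w)
  have hw : ‖w‖ ≤ R := by
    refine le_of_mul_le_mul_left ?_ hε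
    linarith
  have hs : s - h₀ ≤ R := by
    refine (le_smoothPosPart δ _).trans (le_of_mul_le_mul_left ?_ hε)
    linarith
  -- The residual is at most 2δ and |z - z̄| = δ, whence the 3 in `hsmall`; the ball constraint on
  -- `x` is inactive.
  have hx3 : ‖x - zbar‖ < ρ := by
    have e : x - zbar = (x - z - G w) + G w + (z - zbar) := by abel
    have h1 : ‖x - zbar‖ ≤ ‖x - z - G w‖ + ‖G w‖ + δ := by
      rw [e]; exact norm_add₃_le
    have h2 : ‖G w‖ ≤ ‖G‖ * R := (G.le_opNorm w).trans (by gcongr)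
    linarith
  obtain ⟨s', hs'⟩ : ∃ s' : ℝ, h x = s' := by
    refine ⟨(h x).toReal, (EReal.coe_toReal ?_ ?_).symm⟩
    · exact (hxs.trans_lt (EReal.coe_lt_top s)).ne
    · exact ((EReal.bot_lt_coe _).trans (hlow x hxρ')).ne'
  -- Strict monotonicity of the penalty puts the minimizer on the graph of `h`.
  have hss : s' = s := by
    have hle : s' ≤ s := by rw [hs'] at hxs; exact_mod_cast hxs
    refine hle.antisymm ?_
    by_contra! hlt
    have h1 := hmin' x s' w hxρ' (by linarith) (by linarith) hs'.le
    have h2 := smoothPosPart_strictMono hδ (sub_lt_sub_right hlt h₀)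
    nlinarith
  subst hss
  have hpne : x - z - G w ≠ 0 := by
    intro h1
    have h2 : z + G w = x := by rw [sub_sub] at h1; exact (sub_eq_zero.1 h1).symm
    refine hno w hw ?_
    rw [h2, hs', ← EReal.coe_add]
    exact_mod_cast (by linarith : s' ≤ h₀ + R)
  set a := ε * (1 + (s' - h₀) / √((s' - h₀) ^ 2 + δ ^ 2)) with ha_def
  have hslope := smoothPosPart_slope_mem hδ (s' - h₀)
  refine ⟨x, -(‖x - z - G w‖⁻¹ • (x - z - G w)), s', a, hs', hxρ', ?_, ?_, ?_,
    mul_pos hε hslope.1, by nlinarith, ?_⟩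
  · rw [abs_le]; constructor <;> linarith
  · rw [norm_neg, norm_smul, norm_inv, norm_norm, inv_mul_cancel₀ (norm_ne_zero_iff.2 hpne)]
  · rw [map_neg, norm_neg]
    refine norm_adjoint_le_of_isMin hpne ?_ hε.le
    have : ∀ᶠ w' in 𝓝 w, ‖w'‖ < R + 1 :=
      continuous_norm.continuousAt.eventually_lt continuousAt_const (by linarith)
    filter_upwards [this] with w' hw'
    have := hmin' x s' w' hxρ' hs2 hw'.le hs'.le
    linarith
  · have e : x - z - G w = x - (z + G w) := sub_sub _ _ _
    rw [e]
    refine mem_regularSubdifferential_of_isMin (b := h₀ + η) hs' (e ▸ hpne) hε hδ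
      (by linarith) ?_
    have hc : Continuous fun y : E => ‖y - zbar‖ := by fun_prop
    filter_upwards [hc.continuousAt.eventually_lt continuousAt_const hx3] with y hy r hr hrb
    have := hmin' y r w hy.le hrb (by linarith) hr
    rw [sub_sub, sub_sub] at this
    linarith

/-- Failure of the conclusion for every constant yields asymptotically horizontal regular
subgradients asymptotically annihilated by the adjoint of `Gbar`. -/
lemma exists_regularSubgradient_of_frequently [ProperSpace E] [ProperSpace F] {h : E → EReal}
    (hlsc : LowerSemicontinuous h) {zbar : E} {h₀ : ℝ} (h0 : h zbar = h₀) (Gbar : F →L[ℝ] E)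
    (hfreq : ∀ γ : ℝ, 0 < γ → ∃ᶠ p : E × (F →L[ℝ] E) in 𝓝 (zbar, Gbar),
      ∀ w : F, ‖w‖ ≤ γ * ‖p.1 - zbar‖ →
        ¬ h (p.1 + p.2 w) ≤ h zbar + ((γ * ‖p.1 - zbar‖ : ℝ) : EReal))
    {ε : ℝ} (hε : 0 < ε) (hε1 : ε ≤ 1) :
    ∃ (x u : E) (s a : ℝ), h x = s ∧ ‖x - zbar‖ ≤ ε ∧ |s - h₀| ≤ ε ∧ ‖u‖ = 1 ∧
      ‖ContinuousLinearMap.adjoint Gbar u‖ ≤ 2 * ε ∧ 0 < a ∧ a ≤ 2 * ε ∧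
      a⁻¹ • u ∈ regularSubdifferential h x := by
  have hlow : ∀ᶠ x in 𝓝 zbar, ((h₀ - ε : ℝ) : EReal) < h x := by
    refine hlsc zbar _ ?_
    change _ < h zbar
    rw [h0]
    exact_mod_cast (by linarith : h₀ - ε < h₀)
  obtain ⟨ρ₀, hρ₀, hball⟩ := Metric.eventually_nhds_iff.1 hlow
  set ρ := min (ρ₀ / 2) ε with hρ_def
  have hρ : 0 < ρ := lt_min (by positivity) hε
  have ev1 : ∀ᶠ p : E × (F →L[ℝ] E) in 𝓝 (zbar, Gbar),
      3 * ‖p.1 - zbar‖ + ‖p.2‖ * (2 / ε * ‖p.1 - zbar‖) < ρ := by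
    have hc : Continuous fun p : E × (F →L[ℝ] E) =>
      3 * ‖p.1 - zbar‖ + ‖p.2‖ * (2 / ε * ‖p.1 - zbar‖) := by fun_prop
    exact hc.continuousAt.eventually_lt continuousAt_const (by simpa using hρ)
  have ev2 : ∀ᶠ p : E × (F →L[ℝ] E) in 𝓝 (zbar, Gbar), 2 / ε * ‖p.1 - zbar‖ < ε := by
    have hc : Continuous fun p : E × (F →L[ℝ] E) => 2 / ε * ‖p.1 - zbar‖ := by fun_prop
    exact hc.continuousAt.eventually_lt continuousAt_const (by simpa using hε)
  have ev3 : ∀ᶠ p : E × (F →L[ℝ] E) in 𝓝 (zbar, Gbar), ‖p.2 - Gbar‖ < ε := by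
    have hc : Continuous fun p : E × (F →L[ℝ] E) => ‖p.2 - Gbar‖ := by fun_prop
    exact hc.continuousAt.eventually_lt continuousAt_const (by simpa using hε)
  obtain ⟨⟨z, G⟩, hno, h1, h2, h3⟩ :=
    ((hfreq (2 / ε) (by positivity)).and_eventually (ev1.and (ev2.and ev3))).exists
  have hz : z ≠ zbar := by
    rintro rfl
    exact hno 0 (by simp) (by simp)
  obtain ⟨x, u, s, a, hxs, hx, hs, hu, hGu, ha, ha2, hmem⟩ :=
    exists_regularSubgradient_of_no_solution hlsc (η := ε) h0
      (fun x hx => hball (by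
        rw [dist_eq_norm]
        exact hx.trans_lt ((min_le_left _ _).trans_lt (by linarith))))
      G hε hε1 hz h1 h2 (by simpa only [h0] using hno)
  refine ⟨x, u, s, a, hxs, hx.trans (min_le_right _ _), hs, hu, ?_, ha, ha2, hmem⟩
  have e : ContinuousLinearMap.adjoint Gbar u = ContinuousLinearMap.adjoint G u -
      ContinuousLinearMap.adjoint (G - Gbar) u := by
    rw [map_sub, sub_apply]; abel
  have h4 : ‖ContinuousLinearMap.adjoint (G - Gbar) u‖ ≤ ε := by
    refine (ContinuousLinearMap.le_opNorm _ u).trans ?_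
    rw [hu, mul_one, LinearIsometryEquiv.norm_map]
    exact h3.le
  rw [e]
  exact (norm_sub_le _ _).trans (by linarith)

/-- A sequence of asymptotically horizontal regular subgradients, asymptotically annihilated by the
adjoint of `G`, produces a nonzero horizon subgradient in the null space of the adjoint. -/
lemma exists_unit_mem_horizonSubdifferential [ProperSpace E] [CompleteSpace F] {h : E → EReal}
    {zbar : E} {h₀ : ℝ} (h0 : h zbar = h₀) (G : F →L[ℝ] E)
    (hseq : ∀ ε : ℝ, 0 < ε → ε ≤ 1 →
      ∃ (x u : E) (s a : ℝ), h x = s ∧ ‖x - zbar‖ ≤ ε ∧ |s - h₀| ≤ ε ∧ ‖u‖ = 1 ∧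
        ‖ContinuousLinearMap.adjoint G u‖ ≤ 2 * ε ∧ 0 < a ∧ a ≤ 2 * ε ∧
        a⁻¹ • u ∈ regularSubdifferential h x) :
    ∃ v ∈ horizonSubdifferential h zbar, ‖v‖ = 1 ∧ ContinuousLinearMap.adjoint G v = 0 := by
  have hε : Tendsto (fun k : ℕ => 1 / ((k : ℝ) + 1)) atTop (𝓝 0) :=
    tendsto_one_div_add_atTop_nhds_zero_nat
  choose x u s a hxs hx hs hu hGu ha ha2 hmem using fun k : ℕ =>
    hseq (1 / ((k : ℝ) + 1)) (by positivity)
      (by rw [div_le_one (by positivity)]; linarith [(Nat.cast_nonneg k : (0 : ℝ) ≤ k)])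
  obtain ⟨v, hv, φ, hφ, hlim⟩ := (isCompact_sphere (0 : E) 1).tendsto_subseq (x := u)
    (fun k => by simp [hu k])
  have hε2 : Tendsto (fun k : ℕ => 2 * (1 / ((k : ℝ) + 1))) atTop (𝓝 0) := by
    simpa using hε.const_mul 2
  have hxlim : Tendsto x atTop (𝓝 zbar) := by
    rw [tendsto_iff_norm_sub_tendsto_zero]
    exact squeeze_zero (fun _ => norm_nonneg _) hx hε
  have hslim : Tendsto s atTop (𝓝 h₀) := by
    rw [tendsto_iff_norm_sub_tendsto_zero]
    exact squeeze_zero (fun _ => norm_nonneg _) hs hε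
  have halim : Tendsto a atTop (𝓝 0) := squeeze_zero (fun k => (ha k).le) ha2 hε2
  have hGlim : Tendsto (fun k => ContinuousLinearMap.adjoint G (u k)) atTop (𝓝 0) :=
    squeeze_zero_norm hGu hε2
  -- Scaling by t = a turns the subgradients u/a back into unit vectors.
  refine ⟨v, ⟨x ∘ φ, fun k => (a (φ k))⁻¹ • u (φ k), a ∘ φ, hxlim.comp hφ.tendsto_atTop, ?_,
    fun k => hmem _, fun k => ha _, halim.comp hφ.tendsto_atTop, ?_⟩, by simpa using hv, ?_⟩
  · simp only [Function.comp_apply, hxs, h0]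
    exact (continuous_coe_real_ereal.tendsto h₀).comp (hslim.comp hφ.tendsto_atTop)
  · refine hlim.congr fun k => ?_
    simp [smul_smul, mul_inv_cancel₀ (ha (φ k)).ne']
  · exact tendsto_nhds_unique
      (((ContinuousLinearMap.adjoint G).continuous.tendsto v).comp hlim)
      (hGlim.comp hφ.tendsto_atTop)

end Optimality

theorem mainTheorem7 (m n : ℕ)
    (h : EuclideanSpace ℝ (Fin m) → EReal) (hlsc : LowerSemicontinuous h)
    (zbar : EuclideanSpace ℝ (Fin m)) (hbot : h zbar ≠ ⊥) (htop : h zbar ≠ ⊤)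
    (Gbar : EuclideanSpace ℝ (Fin n) →L[ℝ] EuclideanSpace ℝ (Fin m))
    (htrans : horizonSubdifferential h zbar ∩ {v | ContinuousLinearMap.adjoint Gbar v = 0} = {0}) :
    ∃ γ : ℝ, 0 < γ ∧
      ∀ᶠ p : EuclideanSpace ℝ (Fin m) ×
          (EuclideanSpace ℝ (Fin n) →L[ℝ] EuclideanSpace ℝ (Fin m)) in 𝓝 (zbar, Gbar),
        ∃ w : EuclideanSpace ℝ (Fin n),
          ‖w‖ ≤ γ * ‖p.1 - zbar‖ ∧
          h (p.1 + p.2 w) ≤ h zbar + ((γ * ‖p.1 - zbar‖ : ℝ) : EReal) := by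
  lift h zbar to ℝ using ⟨htop, hbot⟩ with h₀ h0
  rw [h0]
  by_contra! hcon
  obtain ⟨v, hv, hv1, hGv⟩ := exists_unit_mem_horizonSubdifferential h0.symm Gbar
    fun ε hε hε1 => exists_regularSubgradient_of_frequently hlsc h0.symm Gbar
      (fun γ hγ => by simpa only [not_eventually, not_exists, not_and, not_le, h0] using hcon γ hγ) hε hε1
  have hv0 : v ∈ ({0} : Set (EuclideanSpace ℝ (Fin m))) := htrans ▸ ⟨hv, hGv⟩
  rw [Set.mem_singleton_iff.1 hv0, norm_zero] at hv1
  exact zero_ne_one hv1
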